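/- Let $K$ be an algebraically closed field and $R=K[x_0,x_1,x_2]=\bigoplus_t R_t$ the homogeneous coordinate ring of $\mathbb P^2=\mathbb P^2_K$ (with $R_t=0$ for $t<0$). Let $p_1,\dots,p_r\in\mathbb P^2$ be points, let $m_1,\dots,m_r\ge 0$ be integers, and let $A_0=m_1p_1+\cdots+m_rp_r$ be the fat point scheme defined by the ideal $I_{A_0}=\bigcap_i I_{p_i}^{m_i}$, where $I_{p_i}\subset R$ is the ideal generated by all forms vanishing at $p_i$. Let $n\ge 0$ and let $L_1,\dots,L_{n+1}\subset\mathbb P^2$ be lines, not necessarily distinct, defined by nonzero linear forms $F_1,\dots,F_{n+1}$. For $1\le j\le n+1$ let $A_j$ be the residual of $A_{j-1}$ with respect to $L_j$, that is, the scheme with ideal $I_{A_j}=(I_{A_{j-1}}:F_j)$. Assume that the sequence $L_1,\dots,L_{n+1}$ totally reduces $A_0$, i.e. $A_{n+1}=\varnothing$ (equivalently $I_{A_{n+1}}=R$), and let ${\bf d}=(d_1,\dots,d_{n+1})$ be the reduction vector, where $d_j=\deg(L_j\cap A_{j-1})$ is the degree of the scheme-theoretic intersection (the value of $\dim_K\big(R/(I_{A_{j-1}}+(F_j))\big)_t$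 for $t\gg0$). For $a\in\mathbb Z$ and $k\ge 1$ let $\binom ak$ be the usual binomial coefficient if $a\ge 0$, and $\binom ak=0$ if $a<0$. For $t\in\mathbb Z$ and $0\le i\le n+1$ put \[ h_i'=\binom{t-i+2}{2}-\sum_{i+1\le j\le n+1}d_j , \] so that $h_{n+1}'=\binom{t-(n+1)+2}{2}$. Then for every $t\in\mathbb Z$ \[ \max(h_0',\dots,h_{n+1}')\;\le\;\dim_K (I_{A_0})_t\;\le\;\binom{t-n+1}{2}+\sum_{i=0}^n\binom{t-i-d_{i+1}+1}{1}. \] Equivalently, in terms of the Hilbert function $h_{A_0}(t)=\dim_K(R/I_{A_0})_t$ of $A_0$, \[ f_{\bf d}(t)\le h_{A_0}(t)\le F_{\bf d}(t)\qquad\text{for every } t, \] where \[ f_{\bf d}(t)=\sum_{i=0}^n\binom{\min(t-i+1,\,d_{i+1})}{1},\qquad F_{\bf d}(t)=\min_{0\le i\le n+1}\Bigg(\binom{t+2}{2}-\binom{t-i+2}{2}+\sum_{i+1\le j\le n+1}d_j\Bigg). \] -/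

import Mathlib

open scoped LinearAlgebra.Projectivization

noncomputable section

namespace FatPoints

/-- The binomial coefficient `C(a, k)` with an integer upper entry,
with the convention that it vanishes for `a < k` (in particular for negative `a`; `k ≥ 1`). -/
def binom (a : ℤ) (k : ℕ) : ℤ := (a.toNat.choose k : ℕ)

/-- The homogeneous coordinate ring `K[x₀, x₁, x₂]` of the projective plane over `K`. -/
abbrev CoordRing (K : Type*) [Field K] : Type _ := MvPolynomial (Fin 3) K

variable {K : Type*} [Field K]

/-- The space `R_t` of forms of degree `t` in `R = K[x₀, x₁, x₂]`; it is zero for `t < 0`. -/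
def forms (K : Type*) [Field K] (t : ℤ) : Submodule K (CoordRing K) :=
  if 0 ≤ t then MvPolynomial.homogeneousSubmodule (Fin 3) K t.toNat else ⊥

/-- The degree `t` part `I_t` of an ideal: the space of forms of degree `t` lying in `I`. -/
def gradedPart (I : Ideal (CoordRing K)) (t : ℤ) : Submodule K (CoordRing K) :=
  I.restrictScalars K ⊓ forms K t

/-- The Hilbert function `t ↦ dim I_t` of a homogeneous ideal `I`. -/
def idealHilbert (I : Ideal (CoordRing K)) (t : ℤ) : ℕ :=
  Module.finrank K (gradedPart I t)

/-- The Hilbert function `t ↦ dim (R / I)_t = dim (R_t / I_t)` of the subscheme defined by the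
homogeneous ideal `I`. -/
def schemeHilbert (I : Ideal (CoordRing K)) (t : ℤ) : ℕ :=
  Module.finrank K (forms K t ⧸ (gradedPart I t).submoduleOf (forms K t))

/-- The degree of the (zero-dimensional or empty) subscheme of the plane defined by the homogeneous
ideal `I`: the value of its Hilbert function `dim (R / I)_t` for `t ≫ 0`. -/
def schemeDegree (I : Ideal (CoordRing K)) : ℕ :=
  Filter.limsup (fun t : ℕ => schemeHilbert I (t : ℤ)) Filter.atTop

theorem schemeDegree_eq {I : Ideal (CoordRing K)} {d : ℕ}
    (h : ∀ᶠ t : ℕ in Filter.atTop, schemeHilbert I (t : ℤ) = d) : schemeDegree I = d := by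
  unfold schemeDegree
  rw [Filter.limsup_congr h, Filter.limsup_const]

/-- The ideal of a point `p` of the projective plane, generated by all forms that vanish at `p`. -/
def pointIdeal (p : ℙ K (Fin 3 → K)) : Ideal (CoordRing K) :=
  Ideal.span {f | (∃ k : ℕ, f.IsHomogeneous k) ∧ MvPolynomial.eval p.rep f = 0}

/-- The ideal `⋂ i, I(pᵢ) ^ mᵢ` defining the fat point scheme `m₁ p₁ + ⋯ + m_r p_r`. -/
def fatPointIdeal {r : ℕ} (p : Fin r → ℙ K (Fin 3 → K)) (m : Fin r → ℕ) : Ideal (CoordRing K) :=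
  ⨅ i, pointIdeal (p i) ^ m i

/-- `F` is the defining form of a line in the projective plane: a nonzero linear form. -/
def IsLineForm (F : CoordRing K) : Prop := F.IsHomogeneous 1 ∧ F ≠ 0

/-- The ideals of the successive residuals `A₀ = A`, `A_j = A_{j-1} : L_j`, where `I` is the ideal
of `A`: the ideal of `A_j` is the ideal quotient of the ideal of `A_{j-1}` by the linear form of
`L_j`. The form of the line `L_{j+1}` is `F j` for `j = 0, …, k - 1`. -/
def residualIdeal (I : Ideal (CoordRing K)) {k : ℕ} (F : Fin k → CoordRing K) :
    Fin (k + 1) → Ideal (CoordRing K) :=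
  Fin.induction I fun j J => J.colon {F j}

/-- The lines totally reduce the scheme `A` with ideal `I`: the last residual is the empty scheme,
whose ideal is the unit ideal (the residuals of a fat point scheme have saturated ideals). -/
def TotallyReduces (I : Ideal (CoordRing K)) {k : ℕ} (F : Fin k → CoordRing K) : Prop :=
  residualIdeal I F (Fin.last k) = ⊤

/-- The reduction vector of the scheme with ideal `I` and the given sequence of lines. Its entry
`j = 0, …, k - 1` is `d_{j+1}`, the degree of the scheme-theoretic intersection of `L_{j+1}` with
`A_j`, which is defined by the sum of the two ideals. -/
def reductionVector (I : Ideal (CoordRing K)) {k : ℕ} (F : Fin k → CoordRing K) (j : Fin k) : ℕ :=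
  schemeDegree (residualIdeal I F j.castSucc ⊔ Ideal.span {F j})

/-- `h'_i(t) = C(t - i + 2, 2) - ∑_{j > i} d_j` for `0 ≤ i ≤ n + 1`, with `d j` standing for
`d_{j+1}`. The sum is empty for `i = n + 1`. -/
def hPrime {n : ℕ} (d : Fin (n + 1) → ℕ) (t : ℤ) (i : Fin (n + 2)) : ℤ :=
  binom (t - (i : ℕ) + 2) 2 - ∑ j with i ≤ Fin.castSucc j, (d j : ℤ)

/-- `f_d(t) = ∑_{i=0}^{n} C(min(t - i + 1, d_{i+1}), 1)`. -/
def fLower {n : ℕ} (d : Fin (n + 1) → ℕ) (t : ℤ) : ℤ :=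
  ∑ i : Fin (n + 1), binom (min (t - (i : ℕ) + 1) (d i)) 1

/-- `F_d(t) = min_{0 ≤ i ≤ n+1} (C(t + 2, 2) - C(t - i + 2, 2) + ∑_{j > i} d_j)`. -/
def FUpper {n : ℕ} (d : Fin (n + 1) → ℕ) (t : ℤ) : ℤ :=
  Finset.univ.inf' Finset.univ_nonempty fun i : Fin (n + 2) =>
    binom (t + 2) 2 - binom (t - (i : ℕ) + 2) 2
      + ∑ j with i ≤ Fin.castSucc j, (d j : ℤ)

end FatPoints

end

namespace FatPoints

open MvPolynomial

attribute [local instance] MvPolynomial.gradedAlgebra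

variable {K : Type*} [Field K]

/-! ### Forms and Hilbert functions -/

theorem forms_natCast (t : ℕ) : forms K (t : ℤ) = homogeneousSubmodule (Fin 3) K t := by
  simp [forms]

theorem forms_of_neg {t : ℤ} (ht : t < 0) : forms K t = ⊥ := by
  simp [forms, not_le.2 ht]

theorem binom_of_nonpos {a : ℤ} (ha : a ≤ 0) {k : ℕ} (hk : k ≠ 0) : binom a k = 0 := by
  obtain ⟨k, rfl⟩ := Nat.exists_eq_succ_of_ne_zero hk
  simp [binom, Int.toNat_of_nonpos ha]

theorem binom_one (a : ℤ) : binom a 1 = max a 0 := by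
  simp [binom]

theorem binom_two_succ (a : ℤ) : binom (a + 1) 2 = binom a 2 + max a 0 := by
  obtain ha | ha := lt_or_ge a 0
  · rw [binom_of_nonpos (by omega) two_ne_zero, binom_of_nonpos ha.le two_ne_zero]
    omega
  · lift a to ℕ using ha
    have h : ((a : ℤ) + 1).toNat = a + 1 := by omega
    simp only [binom, h, Int.toNat_natCast, Nat.choose_succ_succ' a 1, Nat.choose_one_right]
    push_cast
    omega

instance finiteDimensional_forms (t : ℤ) : FiniteDimensional K (forms K t) := by
  refine Module.Finite.iff_fg.2 ?_
  unfold forms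
  split_ifs
  · exact homogeneousSubmodule_fg (Fin 3) K _
  · exact Submodule.fg_bot

instance finiteDimensional_gradedPart (I : Ideal (CoordRing K)) (t : ℤ) :
    FiniteDimensional K (gradedPart I t) :=
  Submodule.finiteDimensional_inf_right _ _

theorem finrank_homogeneousSubmodule (t : ℕ) :
    Module.finrank K (homogeneousSubmodule (Fin 3) K t) = (t + 2).choose 2 := by
  have hset : {d : Fin 3 →₀ ℕ | d.degree = t}
      = ((Finset.univ : Finset (Fin 3)).finsuppAntidiag t : Set (Fin 3 →₀ ℕ)) := by
    ext d
    simp [Finset.mem_finsuppAntidiag, Finsupp.degree_eq_sum]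
  rw [homogeneousSubmodule_eq_finsupp_supported, hset,
    (AddMonoidAlgebra.supportedEquivFinsupp (R := K) (S := K) _).finrank_eq,
    Module.finrank_finsupp_self]
  simp only [SetLike.coe_sort_coe, Fintype.card_coe, Finset.card_finsuppAntidiag_nat_eq_choose,
    Finset.card_univ, Fintype.card_fin]
  rw [show 3 + t - 1 = t + 2 by omega, ← Nat.choose_symm_add]

theorem finrank_forms (t : ℤ) : (Module.finrank K (forms K t) : ℤ) = binom (t + 2) 2 := by
  obtain ht | ht := lt_or_ge t 0
  · rw [forms_of_neg ht, finrank_bot, eq_comm]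
    obtain h | h : t + 2 ≤ 0 ∨ t = -1 := by omega
    · exact binom_of_nonpos h two_ne_zero
    · subst h; simp [binom]
  · lift t to ℕ using ht
    rw [forms_natCast, finrank_homogeneousSubmodule]
    simp only [binom]
    congr

theorem schemeHilbert_add_idealHilbert (I : Ideal (CoordRing K)) (t : ℤ) :
    (schemeHilbert I t : ℤ) + idealHilbert I t = binom (t + 2) 2 := by
  rw [← finrank_forms (K := K), schemeHilbert, idealHilbert,
    ← (Submodule.submoduleOfEquivOfLe
      (show gradedPart I t ≤ forms K t from inf_le_right)).finrank_eq]
  exact_mod_cast Submodule.finrank_quotient_add_finrank _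

theorem schemeHilbert_eq (I : Ideal (CoordRing K)) (t : ℤ) :
    (schemeHilbert I t : ℤ) = binom (t + 2) 2 - idealHilbert I t :=
  eq_sub_of_add_eq (schemeHilbert_add_idealHilbert I t)

theorem gradedPart_mono {I J : Ideal (CoordRing K)} (h : I ≤ J) (t : ℤ) :
    gradedPart I t ≤ gradedPart J t :=
  inf_le_inf_right _ h

theorem idealHilbert_mono {I J : Ideal (CoordRing K)} (h : I ≤ J) (t : ℤ) :
    idealHilbert I t ≤ idealHilbert J t :=
  Submodule.finrank_mono (gradedPart_mono h t)

theorem schemeHilbert_anti {I J : Ideal (CoordRing K)} (h : I ≤ J) (t : ℤ) :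
    schemeHilbert J t ≤ schemeHilbert I t := by
  have h1 := schemeHilbert_eq I t
  have h2 := schemeHilbert_eq J t
  have h3 := idealHilbert_mono h t
  omega

theorem schemeHilbert_top (t : ℤ) : schemeHilbert (⊤ : Ideal (CoordRing K)) t = 0 := by
  have h := schemeHilbert_eq (⊤ : Ideal (CoordRing K)) t
  have h2 : (idealHilbert (⊤ : Ideal (CoordRing K)) t : ℤ) = binom (t + 2) 2 := by
    rw [← finrank_forms (K := K), idealHilbert, gradedPart, Submodule.restrictScalars_top,
      top_inf_eq]
  omega

theorem schemeHilbert_bot (t : ℤ) :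
    (schemeHilbert (⊥ : Ideal (CoordRing K)) t : ℤ) = binom (t + 2) 2 := by
  rw [schemeHilbert_eq, idealHilbert, gradedPart, Submodule.restrictScalars_bot, bot_inf_eq,
    finrank_bot, Nat.cast_zero, sub_zero]

/-! ### Multiplication by a linear form -/

theorem homogeneousComponent_succ_mul {F : CoordRing K} (hF : F.IsHomogeneous 1)
    (b : CoordRing K) (k : ℕ) :
    homogeneousComponent (k + 1) (F * b) = F * homogeneousComponent k b := by
  conv_lhs => rw [← sum_homogeneousComponent b, Finset.mul_sum, map_sum]
  have h (i : ℕ) : homogeneousComponent (k + 1) (F * homogeneousComponent i b)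
      = if i = k then F * homogeneousComponent k b else 0 := by
    have hi : F * homogeneousComponent i b ∈ homogeneousSubmodule (Fin 3) K (i + 1) := by
      rw [add_comm]
      exact hF.mul (homogeneousComponent_isHomogeneous i b)
    rw [homogeneousComponent_of_mem hi]
    split_ifs with h1 h2 h2
    · rw [h2]
    · omega
    · omega
    · rfl
  simp only [h, Finset.sum_ite_eq', Finset.mem_range]
  split_ifs with hk
  · rfl
  · rw [homogeneousComponent_eq_zero _ _ (by omega), mul_zero]

theorem homogeneousComponent_zero_mul {F : CoordRing K} (hF : F.IsHomogeneous 1)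
    (b : CoordRing K) : homogeneousComponent 0 (F * b) = 0 := by
  have h : coeff 0 F = 0 := hF.coeff_eq_zero (by simp)
  rw [homogeneousComponent_zero, ← constantCoeff_eq]
  rw [map_mul, constantCoeff_eq, h, zero_mul, C_0]

theorem mul_mem_forms {F : CoordRing K} (hF : F.IsHomogeneous 1) {t : ℤ} {g : CoordRing K}
    (hg : g ∈ forms K (t - 1)) : F * g ∈ forms K t := by
  obtain ht | ht := lt_or_ge (t - 1) 0
  · rw [forms_of_neg ht, Submodule.mem_bot] at hg
    simp [hg]
  · obtain ⟨k, hk⟩ := Int.eq_ofNat_of_zero_le ht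
    obtain rfl : t = ((k + 1 : ℕ) : ℤ) := by push_cast; omega
    rw [hk, forms_natCast] at hg
    rw [forms_natCast, add_comm]
    exact hF.mul hg

/-- A homogeneous ideal of the coordinate ring. -/
abbrev IsHomogeneousIdeal (I : Ideal (CoordRing K)) : Prop :=
  I.IsHomogeneous (homogeneousSubmodule (Fin 3) K)

theorem isHomogeneousIdeal_iff {I : Ideal (CoordRing K)} :
    IsHomogeneousIdeal I ↔ ∀ f ∈ I, ∀ k, homogeneousComponent k f ∈ I := by
  refine ⟨fun h f hf k => homogeneousComponent_mem_of_mem h hf k, fun h k f hf => ?_⟩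
  have := h f hf k
  rwa [← decomposition.decompose'_apply] at this

theorem isHomogeneousIdeal_span {s : Set (CoordRing K)}
    (h : ∀ f ∈ s, ∃ k, f.IsHomogeneous k) : IsHomogeneousIdeal (Ideal.span s) :=
  Ideal.homogeneous_span _ s h

theorem isHomogeneousIdeal_span_singleton {F : CoordRing K} (hF : F.IsHomogeneous 1) :
    IsHomogeneousIdeal (Ideal.span {F}) :=
  isHomogeneousIdeal_span fun f hf => ⟨1, by rwa [Set.mem_singleton_iff.1 hf]⟩

theorem IsHomogeneousIdeal.colon {I : Ideal (CoordRing K)} (hI : IsHomogeneousIdeal I)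
    {F : CoordRing K} (hF : F.IsHomogeneous 1) : IsHomogeneousIdeal (I.colon {F}) := by
  rw [isHomogeneousIdeal_iff] at hI ⊢
  intro f hf k
  rw [Submodule.mem_colon_singleton, smul_eq_mul, mul_comm] at hf ⊢
  rw [← homogeneousComponent_succ_mul hF]
  exact hI _ hf _

theorem IsHomogeneousIdeal.pow {I : Ideal (CoordRing K)} (hI : IsHomogeneousIdeal I) (k : ℕ) :
    IsHomogeneousIdeal (I ^ k) := by
  induction k with
  | zero => simpa [Ideal.one_eq_top] using Ideal.IsHomogeneous.top _
  | succ k ih => exact pow_succ I k ▸ Ideal.IsHomogeneous.mul ih hI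

theorem gradedPart_sup_span {I : Ideal (CoordRing K)} (hI : IsHomogeneousIdeal I)
    {F : CoordRing K} (hF : F.IsHomogeneous 1) (t : ℤ) :
    gradedPart (I ⊔ Ideal.span {F}) t
      = gradedPart I t ⊔ (forms K (t - 1)).map (LinearMap.mulLeft K F) := by
  refine le_antisymm ?_ (sup_le (gradedPart_mono le_sup_left t) ?_)
  · rintro f ⟨hfI, hf⟩
    obtain ht | ht := lt_or_ge t 0
    · have : f = 0 := by simpa [forms_of_neg ht] using hf
      simp [this]
    lift t to ℕ using ht
    obtain ⟨a, ha, c, hc, rfl⟩ := Submodule.mem_sup.1 hfI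
    obtain ⟨b, rfl⟩ := Ideal.mem_span_singleton.1 hc
    rw [SetLike.mem_coe, forms_natCast, mem_homogeneousSubmodule] at hf
    rw [← homogeneousComponent_eq_self hf, map_add]
    refine Submodule.add_mem_sup ⟨isHomogeneousIdeal_iff.1 hI a ha t, ?_⟩ ?_
    · rw [SetLike.mem_coe, forms_natCast]
      exact homogeneousComponent_mem t a
    · cases t with
      | zero => rw [homogeneousComponent_zero_mul hF]; exact zero_mem _
      | succ k =>
        rw [homogeneousComponent_succ_mul hF]
        refine ⟨homogeneousComponent k b, ?_, rfl⟩
        rw [show ((k + 1 : ℕ) : ℤ) - 1 = (k : ℤ) by push_cast; omega, SetLike.mem_coe,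
          forms_natCast]
        exact homogeneousComponent_mem k b
  · rintro _ ⟨g, hg, rfl⟩
    exact ⟨Ideal.mem_sup_right (Ideal.mem_span_singleton.2 ⟨g, rfl⟩), mul_mem_forms hF hg⟩

theorem gradedPart_inf_map_mulLeft (I : Ideal (CoordRing K))
    {F : CoordRing K} (hF : F.IsHomogeneous 1) (t : ℤ) :
    gradedPart I t ⊓ (forms K (t - 1)).map (LinearMap.mulLeft K F)
      = (gradedPart (I.colon {F}) (t - 1)).map (LinearMap.mulLeft K F) := by
  ext f
  constructor
  · rintro ⟨⟨hfI, -⟩, g, hg, rfl⟩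
    refine ⟨g, ⟨?_, hg⟩, rfl⟩
    simpa [Submodule.mem_colon_singleton, mul_comm] using hfI
  · rintro ⟨g, ⟨hgI, hg⟩, rfl⟩
    refine ⟨⟨?_, mul_mem_forms hF hg⟩, g, hg, rfl⟩
    simpa [Submodule.mem_colon_singleton, mul_comm] using hgI

theorem finrank_map_mulLeft {F : CoordRing K} (hF : F ≠ 0) (V : Submodule K (CoordRing K)) :
    Module.finrank K (V.map (LinearMap.mulLeft K F)) = Module.finrank K V :=
  (Submodule.equivMapOfInjective _ (fun _ _ h => mul_left_cancel₀ hF h) V).finrank_eq.symm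

/-- Dimension count in the exact sequence
`0 → (R / (I : F))(-1) → R / I → R / (I + F) → 0`. -/
theorem schemeHilbert_eq_colon_add_sup {I : Ideal (CoordRing K)} (hI : IsHomogeneousIdeal I)
    {F : CoordRing K} (hF : IsLineForm F) (t : ℤ) :
    schemeHilbert I t
      = schemeHilbert (I.colon {F}) (t - 1) + schemeHilbert (I ⊔ Ideal.span {F}) t := by
  have h := Submodule.finrank_sup_add_finrank_inf_eq (gradedPart I t)
    ((forms K (t - 1)).map (LinearMap.mulLeft K F))
  rw [← gradedPart_sup_span hI hF.1, gradedPart_inf_map_mulLeft I hF.1, finrank_map_mulLeft hF.2,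
    finrank_map_mulLeft hF.2] at h
  have h1 := schemeHilbert_add_idealHilbert I t
  have h2 := schemeHilbert_add_idealHilbert (I ⊔ Ideal.span {F}) t
  have h3 := schemeHilbert_add_idealHilbert (I.colon {F}) (t - 1)
  have h4 := finrank_forms (K := K) (t - 1)
  simp only [idealHilbert] at h1 h2 h3
  omega

theorem schemeHilbert_colon_le {I : Ideal (CoordRing K)} (hI : IsHomogeneousIdeal I)
    {F : CoordRing K} (hF : IsLineForm F) (t : ℤ) :
    schemeHilbert (I.colon {F}) (t - 1) ≤ schemeHilbert I t := by
  have := schemeHilbert_eq_colon_add_sup hI hF t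
  omega

theorem colon_bot {F : CoordRing K} (hF : F ≠ 0) :
    (⊥ : Ideal (CoordRing K)).colon {F} = ⊥ := by
  ext f
  simp [Submodule.mem_colon_singleton, hF]

/-- The Hilbert function of a line. -/
theorem schemeHilbert_span_singleton {F : CoordRing K} (hF : IsLineForm F) (t : ℤ) :
    (schemeHilbert (Ideal.span {F}) t : ℤ) = max (t + 1) 0 := by
  have h := schemeHilbert_eq_colon_add_sup (Ideal.IsHomogeneous.bot _) hF t
  have h1 := schemeHilbert_bot (K := K) t
  have h2 := schemeHilbert_bot (K := K) (t - 1)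
  have h3 := binom_two_succ (t + 1)
  rw [colon_bot hF.2, bot_sup_eq] at h
  rw [show t - 1 + 2 = t + 1 by ring] at h2
  rw [show t + 1 + 1 = t + 2 by ring] at h3
  omega

/-! ### Linear forms -/

theorem exists_isHomogeneous_one_eval (φ : Module.Dual K (Fin 3 → K)) :
    ∃ l : CoordRing K, l.IsHomogeneous 1 ∧ ∀ v, eval v l = φ v := by
  refine ⟨∑ i, C (φ (Pi.single i 1)) * X i,
    IsHomogeneous.sum _ _ _ fun i _ => isHomogeneous_C_mul_X _ i, fun v => ?_⟩
  rw [LinearMap.pi_apply_eq_sum_univ φ v]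
  simp only [map_sum, map_mul, eval_C, eval_X, smul_eq_mul]
  refine Finset.sum_congr rfl fun i _ => ?_
  rw [mul_comm]
  congr! 2
  ext j
  simp [Pi.single_apply, eq_comm]

theorem isHomogeneous_one_induction {P : CoordRing K → Prop} (hX : ∀ i, P (X i)) (h0 : P 0)
    (hadd : ∀ f g, P f → P g → P (f + g)) (hsmul : ∀ (a : K) f, P f → P (C a * f))
    {F : CoordRing K} (hF : F.IsHomogeneous 1) : P F := by
  rw [← mem_homogeneousSubmodule, homogeneousSubmodule_one_eq_span_X] at hF
  induction hF using Submodule.span_induction with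
  | mem f hf => obtain ⟨i, rfl⟩ := hf; exact hX i
  | zero => exact h0
  | add f g _ _ hf hg => exact hadd f g hf hg
  | smul a f _ hf => rw [smul_eq_C_mul]; exact hsmul a f hf

theorem exists_dual_eval_eq {F : CoordRing K} (hF : F.IsHomogeneous 1) :
    ∃ φ : Module.Dual K (Fin 3 → K), ∀ v, eval v F = φ v := by
  refine isHomogeneous_one_induction (P := fun F => ∃ φ : Module.Dual K (Fin 3 → K),
    ∀ v, eval v F = φ v) (fun i => ⟨LinearMap.proj i, by simp⟩) ⟨0, by simp⟩ ?_ ?_ hF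
  · rintro f g ⟨φ, hφ⟩ ⟨ψ, hψ⟩
    exact ⟨φ + ψ, by simp [hφ, hψ]⟩
  · rintro a f ⟨φ, hφ⟩
    exact ⟨a • φ, by simp [hφ]⟩

theorem eval_eq_zero_of_mem_span {F f : CoordRing K} {v : Fin 3 → K} (hv : eval v F = 0)
    (hf : f ∈ Ideal.span {F}) : eval v f = 0 := by
  obtain ⟨b, rfl⟩ := Ideal.mem_span_singleton.1 hf
  simp [hv]

theorem isLineForm_of_notMem_span {F l : CoordRing K} (hl : l.IsHomogeneous 1)
    (hlF : l ∉ Ideal.span {F}) : IsLineForm l :=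
  ⟨hl, fun h => hlF (h ▸ zero_mem _)⟩

theorem exists_linear_eval_eq_zero_notMem_span {F : CoordRing K} (hF : F.IsHomogeneous 1)
    (v : Fin 3 → K) :
    ∃ l : CoordRing K, l.IsHomogeneous 1 ∧ eval v l = 0 ∧ l ∉ Ideal.span {F} := by
  obtain ⟨φ, hφ⟩ := exists_dual_eval_eq hF
  obtain ⟨w, hw, hwv⟩ : ∃ w ∈ LinearMap.ker φ, w ∉ Submodule.span K {v} := by
    by_contra! h
    have h1 : Module.finrank K (LinearMap.ker φ) ≤ 1 :=
      (Submodule.finrank_mono h).trans ((finrank_span_le_card {v}).trans (by simp))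
    have h2 := φ.finrank_range_add_finrank_ker
    have h3 := Submodule.finrank_le (LinearMap.range φ)
    simp only [Module.finrank_fin_fun, Module.finrank_self] at h2 h3
    omega
  obtain ⟨ψ, hψw, hψ⟩ := Submodule.exists_dual_map_eq_bot_of_notMem hwv inferInstance
  obtain ⟨l, hl, hlψ⟩ := exists_isHomogeneous_one_eval ψ
  refine ⟨l, hl, ?_, fun hlF => hψw ?_⟩
  · rw [hlψ, ← Submodule.mem_bot K, ← hψ]
    exact Submodule.mem_map_of_mem (Submodule.mem_span_singleton_self v)
  · rw [← hlψ]
    exact eval_eq_zero_of_mem_span (by rw [hφ]; exact hw) hlF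

theorem isPrime_span_lineForm {F : CoordRing K} (hF : IsLineForm F) :
    (Ideal.span {F}).IsPrime := by
  rw [Ideal.span_singleton_prime hF.2]
  refine (irreducible_of_totalDegree_eq_one (hF.1.totalDegree hF.2) fun x hx => ?_).prime
  refine IsUnit.mk0 x ?_
  rintro rfl
  exact hF.2 (MvPolynomial.ext _ _ fun d => by simpa using hx d)

theorem exists_lineForm_forall_eval_ne_zero [Infinite K] {ι : Type*} [Finite ι]
    (v : ι → Fin 3 → K) (hv : ∀ i, v i ≠ 0) :
    ∃ l : CoordRing K, IsLineForm l ∧ ∀ i, eval (v i) l ≠ 0 := by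
  obtain ⟨φ, hφ⟩ := Module.exists_dual_forall_apply_ne_zero (K := K)
    (fun i : Option ι => i.elim (Pi.single 0 1) v) (by rintro (_ | i) <;> simp [hv])
  obtain ⟨l, hl, hlφ⟩ := exists_isHomogeneous_one_eval φ
  refine ⟨l, ⟨hl, ?_⟩, fun i => by simpa [hlφ] using hφ (some i)⟩
  rintro rfl
  exact hφ none (by simp [← hlφ])

/-! ### Powers of the ideal of a point -/

theorem aeval_algebraMap_mul {A : Type*} [CommRing A] [Algebra K A] {f : CoordRing K} {k : ℕ}
    (hf : f.IsHomogeneous k) (v : Fin 3 → K) (s : A) :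
    aeval (fun i => algebraMap K A (v i) * s) f = s ^ k * algebraMap K A (eval v f) := by
  rw [aeval_def, eval₂_eq', eval_eq', map_sum, Finset.mul_sum]
  refine Finset.sum_congr rfl fun d hd => ?_
  have hk : ∑ i, d i = k := by
    rw [← Finsupp.degree_eq_sum]
    by_contra h
    exact mem_support_iff.1 hd (hf.coeff_eq_zero h)
  simp only [mul_pow, Finset.prod_mul_distrib, Finset.prod_pow_eq_pow_sum, hk, map_mul, map_prod,
    map_pow]
  ring

theorem isHomogeneousIdeal_pointIdeal (p : ℙ K (Fin 3 → K)) : IsHomogeneousIdeal (pointIdeal p) :=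
  isHomogeneousIdeal_span fun _ hf => hf.1

theorem mem_pointIdeal {p : ℙ K (Fin 3 → K)} {f : CoordRing K} {k : ℕ} (hf : f.IsHomogeneous k)
    (h : eval p.rep f = 0) : f ∈ pointIdeal p :=
  Ideal.subset_span ⟨⟨k, hf⟩, h⟩

/-- The degeneration of the plane to the point `c` along the lines through `c`, where `l` is a
linear form with value `1` at `c`. -/
noncomputable def pointDegeneration (c : Fin 3 → K) (l : CoordRing K) :
    CoordRing K →ₐ[K] Polynomial (CoordRing K) :=
  aeval fun i => Polynomial.C (C (c i) * l) + Polynomial.X * Polynomial.C (X i - C (c i) * l)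

theorem pointDegeneration_of_isHomogeneous_one (c : Fin 3 → K) (l : CoordRing K)
    {F : CoordRing K} (hF : F.IsHomogeneous 1) :
    pointDegeneration c l F
      = Polynomial.C (C (eval c F) * l) + Polynomial.X * Polynomial.C (F - C (eval c F) * l) := by
  refine isHomogeneous_one_induction (P := fun F => pointDegeneration c l F = Polynomial.C
    (C (eval c F) * l) + Polynomial.X * Polynomial.C (F - C (eval c F) * l))
    (fun i => ?_) ?_ (fun f g hf hg => ?_) (fun a f hf => ?_) hF
  · simp [pointDegeneration]
  · simp
  · rw [map_add, hf, hg]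
    simp only [map_add, map_sub, map_mul]
    ring
  · rw [map_mul, hf]
    have : pointDegeneration c l (C a) = Polynomial.C (C a) := by
      rw [← algebraMap_eq, AlgHom.commutes]; rfl
    rw [this]
    simp only [map_sub, map_mul, eval_C]
    ring

theorem eval_one_pointDegeneration (c : Fin 3 → K) (l f : CoordRing K) :
    (pointDegeneration c l f).eval 1 = f := by
  have h : ((Polynomial.aeval (R := CoordRing K) (1 : CoordRing K)).restrictScalars K).comp
      (pointDegeneration c l) = AlgHom.id K _ := by
    ext i : 1
    simp [pointDegeneration]
  have := DFunLike.congr_fun h f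
  simpa [Polynomial.aeval_def, Polynomial.eval₂_eq_eval_map] using this

theorem coeff_zero_pointDegeneration (c : Fin 3 → K) (l : CoordRing K) {f : CoordRing K} {k : ℕ}
    (hf : f.IsHomogeneous k) : (pointDegeneration c l f).coeff 0 = l ^ k * C (eval c f) := by
  have h : ((Polynomial.aeval (R := CoordRing K) (0 : CoordRing K)).restrictScalars K).comp
      (pointDegeneration c l) = aeval fun i => algebraMap K (CoordRing K) (c i) * l := by
    ext i : 1
    simp [pointDegeneration, algebraMap_eq]
  have := DFunLike.congr_fun h f
  rw [aeval_algebraMap_mul hf] at this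
  rw [Polynomial.coeff_zero_eq_eval_zero]
  simpa [Polynomial.aeval_def, Polynomial.eval₂_eq_eval_map, algebraMap_eq] using this

theorem mem_pow_pointIdeal_of_mul_mem {p : ℙ K (Fin 3 → K)} {l : CoordRing K}
    (hl : l.IsHomogeneous 1) (hlp : eval p.rep l ≠ 0) {m : ℕ} {f : CoordRing K}
    (hf : l * f ∈ pointIdeal p ^ m) : f ∈ pointIdeal p ^ m := by
  set a := eval p.rep l
  set c : Fin 3 → K := fun i => p.rep i * a⁻¹ with hc
  have heval {g : CoordRing K} {k : ℕ} (hg : g.IsHomogeneous k) :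
      eval c g = a⁻¹ ^ k * eval p.rep g := by
    simpa [coe_aeval_eq_eval] using aeval_algebraMap_mul hg p.rep a⁻¹
  have hcl : eval c l = 1 := by rw [heval hl, pow_one, inv_mul_cancel₀ hlp]
  set ψ := pointDegeneration c l with hψdef
  have hψl : ψ l = Polynomial.C l := by
    simp [hψdef, pointDegeneration_of_isHomogeneous_one c l hl, hcl]
  have hrees (g : CoordRing K) : ψ g ∈ reesAlgebra (pointIdeal p) := by
    induction g using MvPolynomial.induction_on with
    | C b =>
      rw [← algebraMap_eq, AlgHom.commutes, IsScalarTower.algebraMap_apply K (CoordRing K)]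
      exact (reesAlgebra (pointIdeal p)).algebraMap_mem _
    | add g h hg hh => rw [map_add]; exact add_mem hg hh
    | mul_X g i hg =>
      rw [map_mul]
      refine mul_mem hg ?_
      rw [hψdef, pointDegeneration_of_isHomogeneous_one c l (isHomogeneous_X K i)]
      refine add_mem ((reesAlgebra (pointIdeal p)).algebraMap_mem _) ?_
      rw [mul_comm, ← pow_one Polynomial.X, Polynomial.C_mul_X_pow_eq_monomial]
      refine reesAlgebra.monomial_mem.2 ?_
      rw [pow_one]
      refine mem_pointIdeal (k := 1) ((isHomogeneous_X K i).sub (hl.C_mul _)) ?_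
      simp [hc, a, mul_assoc, inv_mul_cancel₀ hlp]
  have hdvd : pointIdeal p ^ m
      ≤ (Ideal.span {(Polynomial.X : Polynomial (CoordRing K)) ^ m}).comap ψ.toRingHom := by
    rw [← Ideal.span_singleton_pow]
    refine le_trans (Ideal.pow_right_mono (Ideal.span_le.2 ?_) m) (Ideal.le_comap_pow _ m)
    rintro g ⟨⟨k, hg⟩, hgp⟩
    refine Ideal.mem_span_singleton.2 (Polynomial.X_dvd_iff.2 ?_)
    exact (coeff_zero_pointDegeneration c l hg).trans (by simp [heval hg, hgp])
  have hcoeff : ∀ j < m, (ψ f).coeff j = 0 := by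
    intro j hj
    have h1 : Polynomial.X ^ m ∣ Polynomial.C l * ψ f := by
      rw [← hψl, ← map_mul]
      exact Ideal.mem_span_singleton.1 (hdvd hf)
    have h2 := Polynomial.X_pow_dvd_iff.1 h1 j hj
    rw [Polynomial.coeff_C_mul] at h2
    refine (mul_eq_zero.1 h2).resolve_left ?_
    rintro rfl
    exact hlp (map_zero _)
  rw [← eval_one_pointDegeneration c l f, Polynomial.eval_eq_sum_range]
  refine sum_mem fun j _ => ?_
  rw [one_pow, mul_one]
  obtain hj | hj := lt_or_ge j m
  · rw [← hψdef, hcoeff j hj]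
    exact zero_mem _
  · exact Ideal.pow_le_pow_right hj (hrees f j)

/-! ### Ideals of fat points -/

theorem isHomogeneousIdeal_fatPointIdeal {r : ℕ} (p : Fin r → ℙ K (Fin 3 → K)) (m : Fin r → ℕ) :
    IsHomogeneousIdeal (fatPointIdeal p m) :=
  Ideal.IsHomogeneous.iInf fun i => (isHomogeneousIdeal_pointIdeal (p i)).pow (m i)

theorem not_fatPointIdeal_le_span {r : ℕ} (p : Fin r → ℙ K (Fin 3 → K)) (m : Fin r → ℕ)
    {F : CoordRing K} (hF : IsLineForm F) : ¬ fatPointIdeal p m ≤ Ideal.span {F} := by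
  have hprime := isPrime_span_lineForm hF
  intro h
  rw [fatPointIdeal, ← Finset.inf_univ_eq_iInf, hprime.inf_le'] at h
  obtain ⟨i, -, hi⟩ := h
  obtain ⟨l, hl, hlp, hlF⟩ := exists_linear_eval_eq_zero_notMem_span hF.1 (p i).rep
  exact hlF (hprime.le_of_pow_le hi (mem_pointIdeal hl hlp))

theorem exists_fatPointIdeal_colon_le [Infinite K] {r : ℕ} (p : Fin r → ℙ K (Fin 3 → K))
    (m : Fin r → ℕ) :
    ∃ l, IsLineForm l ∧ (fatPointIdeal p m).colon {l} ≤ fatPointIdeal p m := by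
  obtain ⟨l, hl, hlp⟩ := exists_lineForm_forall_eval_ne_zero (fun i => (p i).rep)
    fun i => (p i).rep_nonzero
  refine ⟨l, hl, fun f hf => ?_⟩
  rw [Submodule.mem_colon_singleton, smul_eq_mul, mul_comm, fatPointIdeal, Ideal.mem_iInf] at hf
  exact (Ideal.mem_iInf).2 fun i => mem_pow_pointIdeal_of_mul_mem hl.1 (hlp i) (hf i)

/-! ### Growth of Hilbert functions -/

theorem monotone_schemeHilbert {I : Ideal (CoordRing K)} (hI : IsHomogeneousIdeal I)
    {l : CoordRing K} (hl : IsLineForm l) (h : I.colon {l} ≤ I) : Monotone (schemeHilbert I) := by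
  refine monotone_int_of_le_succ fun t => (schemeHilbert_anti h t).trans ?_
  simpa using schemeHilbert_colon_le hI hl (t + 1)

theorem colon_span_singleton_le {F l : CoordRing K} (hF : IsLineForm F)
    (hlF : l ∉ Ideal.span {F}) : (Ideal.span {F}).colon {l} ≤ Ideal.span {F} :=
  fun _ hf =>
    ((isPrime_span_lineForm hF).mem_or_mem (Submodule.mem_colon_singleton.1 hf)).resolve_right hlF

theorem le_colon (I : Ideal (CoordRing K)) (F : CoordRing K) : I ≤ I.colon {F} := fun _ hf =>
  Submodule.mem_colon_singleton.2 (I.mul_mem_right F hf)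

/-- Two distinct lines meet in a subscheme of degree one. -/
theorem schemeHilbert_span_sup_span {F l : CoordRing K} (hF : IsLineForm F) (hl : IsLineForm l)
    (hlF : l ∉ Ideal.span {F}) {t : ℤ} (ht : 0 ≤ t) :
    schemeHilbert (Ideal.span {F} ⊔ Ideal.span {l}) t = 1 := by
  have h := schemeHilbert_eq_colon_add_sup (isHomogeneousIdeal_span_singleton hF.1) hl t
  rw [le_antisymm (colon_span_singleton_le hF hlF) (le_colon _ _)] at h
  have h1 := schemeHilbert_span_singleton hF t
  have h2 := schemeHilbert_span_singleton hF (t - 1)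
  omega

theorem schemeHilbert_lt_of_mem_of_notMem {I J : Ideal (CoordRing K)} (h : I ≤ J) {t : ℤ}
    {g : CoordRing K} (hg : g ∈ forms K t) (hgJ : g ∈ J) (hgI : g ∉ I) :
    schemeHilbert J t < schemeHilbert I t := by
  have h1 := schemeHilbert_eq I t
  have h2 := schemeHilbert_eq J t
  have h3 : idealHilbert I t < idealHilbert J t :=
    Submodule.finrank_lt_finrank_of_lt (lt_of_le_of_ne (gradedPart_mono h t) fun he =>
      hgI (he.ge (show g ∈ gradedPart J t from ⟨hgJ, hg⟩)).1)
  omega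

section IsAlgClosed

variable [IsAlgClosed K]

theorem exists_eval_eq_zero_eval_ne_zero {F g : CoordRing K} (hF : IsLineForm F)
    (hg : g ∉ Ideal.span {F}) : ∃ v, eval v F = 0 ∧ eval v g ≠ 0 := by
  have := isPrime_span_lineForm hF
  by_contra! h
  refine hg ?_
  rw [← IsPrime.vanishingIdeal_zeroLocus (k := K) (K := K) (Ideal.span {F})]
  intro v hv
  exact h v (hv F (Ideal.mem_span_singleton_self F))

theorem schemeHilbert_succ_le {J : Ideal (CoordRing K)} (hJ : IsHomogeneousIdeal J)
    {F : CoordRing K} (hF : IsLineForm F) (hFJ : Ideal.span {F} ≤ J) {s : ℕ} {g : CoordRing K}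
    (hgs : g.IsHomogeneous s) (hgJ : g ∈ J) (hgF : g ∉ Ideal.span {F}) :
    schemeHilbert J ((s + 1 : ℕ) : ℤ) ≤ schemeHilbert J (s : ℤ) := by
  have hprime := isPrime_span_lineForm hF
  obtain ⟨h, hh, -, hhF⟩ := exists_linear_eval_eq_zero_notMem_span hF.1 0
  obtain ⟨v, hvF, hvg⟩ := exists_eval_eq_zero_eval_ne_zero hF
    (show g * h ∉ Ideal.span {F} from fun hgh => (hprime.mem_or_mem hgh).elim hgF hhF)
  obtain ⟨l, hl, hlv, hlF⟩ := exists_linear_eval_eq_zero_notMem_span hF.1 v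
  have hll := isLineForm_of_notMem_span hl hlF
  have hlt : schemeHilbert (J ⊔ Ideal.span {l}) ((s + 1 : ℕ) : ℤ)
      < schemeHilbert (Ideal.span {F} ⊔ Ideal.span {l}) ((s + 1 : ℕ) : ℤ) := by
    refine schemeHilbert_lt_of_mem_of_notMem (sup_le_sup_right hFJ _) (g := g * h) ?_
      (Ideal.mem_sup_left (J.mul_mem_right h hgJ)) fun hmem => hvg ?_
    · rw [forms_natCast]
      exact hgs.mul hh
    · obtain ⟨a, ha, b, hb, hab⟩ := Submodule.mem_sup.1 hmem
      rw [← hab, map_add, eval_eq_zero_of_mem_span hvF ha, eval_eq_zero_of_mem_span hlv hb,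
        add_zero]
  rw [schemeHilbert_span_sup_span hF hll hlF (Int.natCast_nonneg _)] at hlt
  have h1 := schemeHilbert_eq_colon_add_sup hJ hll ((s + 1 : ℕ) : ℤ)
  have h2 := schemeHilbert_anti (le_colon J l) (s : ℤ)
  rw [show ((s + 1 : ℕ) : ℤ) - 1 = (s : ℤ) by push_cast; ring] at h1
  omega

theorem schemeHilbert_le_of_le {J : Ideal (CoordRing K)} (hJ : IsHomogeneousIdeal J)
    {F : CoordRing K} (hF : IsLineForm F) (hFJ : Ideal.span {F} ≤ J) {s : ℕ} {g : CoordRing K}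
    (hgs : g.IsHomogeneous s) (hgJ : g ∈ J) (hgF : g ∉ Ideal.span {F}) {u w : ℕ} (hsu : s ≤ u)
    (huw : u ≤ w) : schemeHilbert J (w : ℤ) ≤ schemeHilbert J (u : ℤ) := by
  have hprime := isPrime_span_lineForm hF
  obtain ⟨h, hh, -, hhF⟩ := exists_linear_eval_eq_zero_notMem_span hF.1 0
  induction w, huw using Nat.le_induction with
  | base => exact le_rfl
  | succ w hw ih =>
    refine (schemeHilbert_succ_le hJ hF hFJ (g := g * h ^ (w - s)) ?_
      (J.mul_mem_right _ hgJ) fun hmem => ?_).trans ih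
    · convert hgs.mul (hh.pow (w - s)) using 1
      omega
    · exact (hprime.mem_or_mem hmem).elim hgF fun h' => hhF (hprime.mem_of_pow_mem _ h')

theorem eventually_eq_schemeDegree {J : Ideal (CoordRing K)} (hJ : IsHomogeneousIdeal J)
    {F : CoordRing K} (hF : IsLineForm F) (hFJ : Ideal.span {F} ≤ J) {s : ℕ} {g : CoordRing K}
    (hgs : g.IsHomogeneous s) (hgJ : g ∈ J) (hgF : g ∉ Ideal.span {F}) :
    schemeDegree J ≤ schemeHilbert J (s : ℤ) ∧
      ∀ᶠ u : ℕ in Filter.atTop, schemeHilbert J (u : ℤ) = schemeDegree J := by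
  have hle {u w : ℕ} := schemeHilbert_le_of_le hJ hF hFJ hgs hgJ hgF (u := u) (w := w)
  obtain ⟨u, hu⟩ := exists_minimalFor_of_wellFoundedLT (s ≤ ·)
    (fun u : ℕ => schemeHilbert J (u : ℤ)) ⟨s, le_rfl⟩
  have hev : ∀ᶠ w : ℕ in Filter.atTop, schemeHilbert J (w : ℤ) = schemeHilbert J (u : ℤ) := by
    filter_upwards [Filter.eventually_ge_atTop u] with w hw
    have h := hle hu.prop hw
    exact le_antisymm h (hu.le_of_le (hu.prop.trans hw) h)
  rw [schemeDegree_eq hev]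
  exact ⟨hle le_rfl hu.prop, hev⟩

theorem min_schemeDegree_le_schemeHilbert {J : Ideal (CoordRing K)} (hJ : IsHomogeneousIdeal J)
    {F : CoordRing K} (hF : IsLineForm F) (hFJ : Ideal.span {F} ≤ J) (t : ℤ) :
    min (t + 1) (schemeDegree J) ≤ schemeHilbert J t := by
  obtain ht | ht := lt_or_ge t 0
  · exact (min_le_left _ _).trans (by omega)
  lift t to ℕ using ht
  by_cases h : gradedPart J t ≤ gradedPart (Ideal.span {F}) t
  · have h1 : idealHilbert J t ≤ idealHilbert (Ideal.span {F}) t := Submodule.finrank_mono h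
    have h2 := schemeHilbert_span_singleton hF t
    have h3 := schemeHilbert_eq J t
    have h4 := schemeHilbert_eq (Ideal.span {F}) t
    exact (min_le_left _ _).trans (by omega)
  · obtain ⟨g, ⟨hgJ, hg⟩, hgF⟩ := SetLike.not_le_iff_exists.1 h
    refine (min_le_right _ _).trans (Int.ofNat_le.2 ?_)
    refine (eventually_eq_schemeDegree hJ hF hFJ (g := g) ?_ hgJ fun h => hgF ⟨h, hg⟩).1
    rwa [SetLike.mem_coe, forms_natCast] at hg

theorem eventually_schemeHilbert_eq_schemeDegree {J : Ideal (CoordRing K)}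
    (hJ : IsHomogeneousIdeal J) {F : CoordRing K} (hF : IsLineForm F) (hFJ : Ideal.span {F} ≤ J)
    (h : ¬ J ≤ Ideal.span {F}) :
    ∀ᶠ u : ℕ in Filter.atTop, schemeHilbert J (u : ℤ) = schemeDegree J := by
  obtain ⟨f, hfJ, hfF⟩ := SetLike.not_le_iff_exists.1 h
  obtain ⟨s, hs⟩ : ∃ s, homogeneousComponent s f ∉ Ideal.span {F} := by
    by_contra! hall
    exact hfF (sum_homogeneousComponent f ▸ sum_mem fun i _ => hall i)
  exact (eventually_eq_schemeDegree hJ hF hFJ (homogeneousComponent_isHomogeneous s f)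
    (isHomogeneousIdeal_iff.1 hJ f hfJ s) hs).2

end IsAlgClosed

/-! ### Summation along a sequence of residuals -/

theorem eq_last_add_sum_filter {n : ℕ} {S : Fin (n + 2) → ℤ} {G : Fin (n + 1) → ℤ}
    (h : ∀ i, S (Fin.castSucc i) = S i.succ + G i) (i : Fin (n + 2)) :
    S i = S (Fin.last (n + 1)) + ∑ j with i ≤ Fin.castSucc j, G j := by
  induction i using Fin.reverseInduction with
  | last =>
    rw [Finset.filter_false_of_mem fun j _ => not_le.2 (Fin.castSucc_lt_last j)]
    simp
  | cast i ih =>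
    have hfilter : Finset.univ.filter (fun j : Fin (n + 1) => Fin.castSucc i ≤ Fin.castSucc j)
        = insert i (Finset.univ.filter fun j : Fin (n + 1) => i.succ ≤ Fin.castSucc j) := by
      ext j
      simp only [Finset.mem_filter, Finset.mem_univ, true_and, Finset.mem_insert, Fin.le_def,
        Fin.ext_iff, Fin.val_castSucc, Fin.val_succ]
      omega
    rw [hfilter, Finset.sum_insert (by simp [Fin.le_def]), h i, ih]
    ring

theorem residualIdeal_succ (I : Ideal (CoordRing K)) {k : ℕ} (F : Fin k → CoordRing K)
    (i : Fin k) : residualIdeal I F i.succ = (residualIdeal I F i.castSucc).colon {F i} := by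
  simp [residualIdeal]

theorem isHomogeneousIdeal_residualIdeal {I : Ideal (CoordRing K)} (hI : IsHomogeneousIdeal I)
    {k : ℕ} {F : Fin k → CoordRing K} (hF : ∀ j, IsLineForm (F j)) (i : Fin (k + 1)) :
    IsHomogeneousIdeal (residualIdeal I F i) := by
  induction i using Fin.induction with
  | zero => exact hI
  | succ i ih => rw [residualIdeal_succ]; exact IsHomogeneousIdeal.colon ih (hF i).1

theorem le_residualIdeal (I : Ideal (CoordRing K)) {k : ℕ} (F : Fin k → CoordRing K)
    (i : Fin (k + 1)) : I ≤ residualIdeal I F i := by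
  induction i using Fin.induction with
  | zero => exact le_rfl
  | succ i ih => rw [residualIdeal_succ]; exact ih.trans (le_colon _ _)

theorem residualIdeal_colon_le {I : Ideal (CoordRing K)} {l : CoordRing K} (h : I.colon {l} ≤ I)
    {k : ℕ} (F : Fin k → CoordRing K) (i : Fin (k + 1)) :
    (residualIdeal I F i).colon {l} ≤ residualIdeal I F i := by
  induction i using Fin.induction with
  | zero => exact h
  | succ i ih =>
    rw [residualIdeal_succ]
    intro f hf
    simp only [Submodule.mem_colon_singleton, smul_eq_mul] at hf ⊢
    exact ih (Submodule.mem_colon_singleton.2 (by rwa [smul_eq_mul, mul_right_comm]))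

section Residuals

variable {I : Ideal (CoordRing K)} {n : ℕ} {F : Fin (n + 1) → CoordRing K}

theorem schemeHilbert_residualIdeal_castSucc (hI : IsHomogeneousIdeal I)
    (hF : ∀ j, IsLineForm (F j)) (t : ℤ) (i : Fin (n + 1)) :
    schemeHilbert (residualIdeal I F i.castSucc) (t - (i.castSucc : ℕ))
      = schemeHilbert (residualIdeal I F i.succ) (t - (i.succ : ℕ))
        + schemeHilbert (residualIdeal I F i.castSucc ⊔ Ideal.span {F i}) (t - (i : ℕ)) := by
  rw [schemeHilbert_eq_colon_add_sup (isHomogeneousIdeal_residualIdeal hI hF _) (hF i),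
    ← residualIdeal_succ, Fin.val_succ, Fin.val_castSucc]
  congr 2
  push_cast
  ring

/-- The Hilbert function of a residual is the sum of those of the successive linear sections. -/
theorem schemeHilbert_residualIdeal_eq_sum (hI : IsHomogeneousIdeal I)
    (hF : ∀ j, IsLineForm (F j)) (hred : TotallyReduces I F) (t : ℤ) (i : Fin (n + 2)) :
    (schemeHilbert (residualIdeal I F i) (t - (i : ℕ)) : ℤ)
      = ∑ j with i ≤ Fin.castSucc j,
          (schemeHilbert (residualIdeal I F j.castSucc ⊔ Ideal.span {F j}) (t - (j : ℕ)) : ℤ) := by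
  have h := eq_last_add_sum_filter
    (S := fun i => (schemeHilbert (residualIdeal I F i) (t - (i : ℕ)) : ℤ))
    (fun i => by rw [schemeHilbert_residualIdeal_castSucc hI hF t i, Nat.cast_add]) i
  have hlast : residualIdeal I F (Fin.last (n + 1)) = ⊤ := hred
  simpa only [hlast, schemeHilbert_top, Nat.cast_zero, zero_add] using h

theorem schemeHilbert_residualIdeal_le_sum [IsAlgClosed K] (hI : IsHomogeneousIdeal I)
    (hF : ∀ j, IsLineForm (F j)) (hred : TotallyReduces I F)
    (hnot : ∀ j, ¬ I ≤ Ideal.span {F j}) {l : CoordRing K} (hl : IsLineForm l)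
    (hIl : I.colon {l} ≤ I) (t : ℤ) (i : Fin (n + 2)) :
    (schemeHilbert (residualIdeal I F i) t : ℤ)
      ≤ ∑ j with i ≤ Fin.castSucc j, (reductionVector I F j : ℤ) := by
  have hev (j : Fin (n + 1)) : ∀ᶠ u : ℕ in Filter.atTop,
      schemeHilbert (residualIdeal I F j.castSucc ⊔ Ideal.span {F j}) (u : ℤ)
        = reductionVector I F j :=
    eventually_schemeHilbert_eq_schemeDegree
      (Ideal.IsHomogeneous.sup (isHomogeneousIdeal_residualIdeal hI hF _)
        (isHomogeneousIdeal_span_singleton (hF j).1))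
      (hF j) le_sup_right fun h => hnot j ((le_residualIdeal I F _).trans (le_sup_left.trans h))
  obtain ⟨N, hN⟩ := Filter.eventually_atTop.1 (Filter.eventually_all.2 hev)
  have hmono := monotone_schemeHilbert (isHomogeneousIdeal_residualIdeal hI hF i) hl
    (residualIdeal_colon_le hIl F i)
  set u : ℤ := max t 0 + N + (n + 1) with hu
  have h := schemeHilbert_residualIdeal_eq_sum hI hF hred (u + (i : ℕ)) i
  rw [add_sub_cancel_right] at h
  refine (Int.ofNat_le.2 (hmono (show t ≤ u by omega))).trans (h.le.trans ?_)
  refine Finset.sum_le_sum fun j _ => Int.ofNat_le.2 (le_of_eq ?_)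
  have hj := hN (u + (i : ℕ) - (j : ℕ)).toNat (by omega) j
  rwa [Int.toNat_of_nonneg (by omega)] at hj

theorem binom_sub_schemeHilbert_residualIdeal_le (hI : IsHomogeneousIdeal I)
    (hF : ∀ j, IsLineForm (F j)) (t : ℤ) (i : Fin (n + 2)) :
    binom (t - (i : ℕ) + 2) 2 - schemeHilbert (residualIdeal I F i) (t - (i : ℕ))
      ≤ idealHilbert I t := by
  induction i using Fin.induction with
  | zero =>
    have h := schemeHilbert_eq I t
    have h0 : residualIdeal I F 0 = I := rfl
    simp only [Fin.val_zero, Nat.cast_zero, sub_zero, h0]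
    omega
  | succ i ih =>
    refine le_trans ?_ ih
    have h := schemeHilbert_residualIdeal_castSucc hI hF t i
    have h1 := schemeHilbert_anti
      (le_sup_right : Ideal.span {F i} ≤ residualIdeal I F i.castSucc ⊔ _) (t - (i : ℕ))
    have h2 := schemeHilbert_span_singleton (hF i) (t - (i : ℕ))
    have h3 := binom_two_succ (t - (i : ℕ) + 1)
    rw [show t - (i : ℕ) + 1 + 1 = t - (i.castSucc : ℕ) + 2 by rw [Fin.val_castSucc]; ring,
      show t - (i : ℕ) + 1 = t - (i.succ : ℕ) + 2 by rw [Fin.val_succ]; push_cast; ring] at h3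
    have h4 : ((i.succ : ℕ) : ℤ) = (i : ℕ) + 1 := by simp
    omega

theorem fLower_le_schemeHilbert [IsAlgClosed K] (hI : IsHomogeneousIdeal I)
    (hF : ∀ j, IsLineForm (F j)) (hred : TotallyReduces I F) (t : ℤ) :
    fLower (reductionVector I F) t ≤ schemeHilbert I t := by
  have h := schemeHilbert_residualIdeal_eq_sum hI hF hred t 0
  have h0 : residualIdeal I F 0 = I := rfl
  simp only [Fin.val_zero, Nat.cast_zero, sub_zero, Fin.zero_le, Finset.filter_true, h0] at h
  rw [h, fLower]
  refine Finset.sum_le_sum fun j _ => ?_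
  rw [binom_one]
  exact max_le (min_schemeDegree_le_schemeHilbert
    (Ideal.IsHomogeneous.sup (isHomogeneousIdeal_residualIdeal hI hF _)
      (isHomogeneousIdeal_span_singleton (hF j).1)) (hF j) le_sup_right _) (Int.natCast_nonneg _)

end Residuals

theorem binom_sub_fLower {n : ℕ} (d : Fin (n + 1) → ℕ) (t : ℤ) :
    binom (t + 2) 2 - fLower d t
      = binom (t - n + 1) 2 + ∑ i : Fin (n + 1), binom (t - (i : ℕ) - d i + 1) 1 := by
  have h := eq_last_add_sum_filter (S := fun i : Fin (n + 2) => binom (t - (i : ℕ) + 2) 2)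
    (G := fun i => max (t - (i : ℕ) + 1) 0) (fun i => ?_) 0
  · simp only [Fin.val_zero, Nat.cast_zero, sub_zero, Fin.val_last, Fin.zero_le,
      Finset.filter_true] at h
    rw [h, show t - ((n + 1 : ℕ) : ℤ) + 2 = t - n + 1 by push_cast; ring, fLower, add_sub_assoc,
      ← Finset.sum_sub_distrib]
    congr 1
    refine Finset.sum_congr rfl fun i _ => ?_
    rw [binom_one, binom_one]
    omega
  · have h := binom_two_succ (t - (i : ℕ) + 1)
    rw [Fin.val_castSucc, Fin.val_succ]
    convert h using 2
    · ring
    · congr 1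
      push_cast
      ring

theorem FUpper_eq {n : ℕ} (d : Fin (n + 1) → ℕ) (t : ℤ) :
    FUpper d t
      = Finset.univ.inf' Finset.univ_nonempty fun i => binom (t + 2) 2 - hPrime d t i := by
  unfold FUpper hPrime
  congr 1
  ext i
  ring

end FatPoints

theorem mainTheorem3 {K : Type*} [Field K] [IsAlgClosed K]
    {r : ℕ} (p : Fin r → ℙ K (Fin 3 → K)) (m : Fin r → ℕ)
    {n : ℕ} (F : Fin (n + 1) → FatPoints.CoordRing K)
    (hF : ∀ j, FatPoints.IsLineForm (F j))
    (hred : FatPoints.TotallyReduces (FatPoints.fatPointIdeal p m) F)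
    (d : Fin (n + 1) → ℕ)
    (hd : d = FatPoints.reductionVector (FatPoints.fatPointIdeal p m) F)
    (t : ℤ) :
    ((Finset.univ.sup' Finset.univ_nonempty fun i : Fin (n + 2) => FatPoints.hPrime d t i)
        ≤ (FatPoints.idealHilbert (FatPoints.fatPointIdeal p m) t : ℤ) ∧
      (FatPoints.idealHilbert (FatPoints.fatPointIdeal p m) t : ℤ)
        ≤ FatPoints.binom (t - n + 1) 2
          + ∑ i : Fin (n + 1), FatPoints.binom (t - (i : ℕ) - d i + 1) 1) ∧
    (FatPoints.fLower d t ≤ (FatPoints.schemeHilbert (FatPoints.fatPointIdeal p m) t : ℤ) ∧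
      (FatPoints.schemeHilbert (FatPoints.fatPointIdeal p m) t : ℤ) ≤ FatPoints.FUpper d t) := by
  have : Infinite K := IsAlgClosed.instInfinite
  have hI := FatPoints.isHomogeneousIdeal_fatPointIdeal p m
  obtain ⟨l, hl, hIl⟩ := FatPoints.exists_fatPointIdeal_colon_le p m
  have hsum := FatPoints.schemeHilbert_add_idealHilbert (FatPoints.fatPointIdeal p m) t
  have hlower := FatPoints.fLower_le_schemeHilbert hI hF hred t
  have hprime (i : Fin (n + 2)) :
      FatPoints.hPrime d t i ≤ FatPoints.idealHilbert (FatPoints.fatPointIdeal p m) t := by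
    refine le_trans (sub_le_sub_left ?_ _)
      (FatPoints.binom_sub_schemeHilbert_residualIdeal_le hI hF t i)
    rw [hd]
    exact FatPoints.schemeHilbert_residualIdeal_le_sum hI hF hred
      (fun j => FatPoints.not_fatPointIdeal_le_span p m (hF j)) hl hIl _ i
  rw [← hd] at hlower
  refine ⟨⟨Finset.sup'_le _ _ fun i _ => hprime i, ?_⟩, hlower, ?_⟩
  · rw [← FatPoints.binom_sub_fLower]
    linarith
  · rw [FatPoints.FUpper_eq]
    refine Finset.le_inf' _ _ fun i _ => ?_
    linarith [hprime i]
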